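/- Let $B^3\subset\mathbb R^3$ be the closed unit ball and $S^2=\partial B^3$. Let $G:B^3\to\mathbb R^3$ be a smooth (up to the boundary) orientation-preserving immersion, i.e. $\det DG(x)>0$ for every $x\in B^3$, and let $\iota=G|_{S^2}:S^2\to\mathbb R^3$. For $x\in\mathbb R^3\setminus\iota(S^2)$ let $$\deg(G,x)=\sum_{y\in \operatorname{int}B^3,\ G(y)=x}\operatorname{sign}\det DG(y)$$ be the Brouwer degree of $G$ at $x$. A Lipschitz null homotopy of $\iota$ is a Lipschitz map $K:S^2\times[0,1]\to\mathbb R^3$ with $K(\cdot,0)=\iota$ and $K(\cdot,1)$ constant; its swept volume is $$\operatorname{Vol}(K)=\int_{S^2\times[0,1]}JK(p,t)\,dp\,dt,$$ where $JK$ is the $3$-dimensional Jacobian of $K$ and $dp$ is the surface measure of $S^2$. Then the map $$H:S^2\times[0,1]\to\mathbb R^3,\qquad H(p,t)=G((1-t)p),$$ which is $G$ read on the cone $B^3\cong S^2\times[0,1]/S^2\times\{1\}$, is a smooth Lipschitz null homotopy of $\iota$, each point $x\neq G(0)$ has only finitely many preimages under $H$, the set $\iota(S^2)$ is Lebesgue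 null, $x\mapsto\deg(G,x)$ is integrable on $\mathbb R^3$, $\operatorname{Vol}(H)$ is finite, and $$\operatorname{Vol}(H)=\int_{\mathbb R^3}\deg(G,x)\,dx .$$ Moreover $\operatorname{Vol}(K)\ge\bigl|\int_{\mathbb R^3}\deg(G,x)\,dx\bigr|$ for every Lipschitz null homotopy $K$ of $\iota$, so that $H$ attains this lower bound and has the least swept volume among all Lipschitz null homotopies of $\iota$. -/

import Mathlib

open MeasureTheory
open scoped ContDiff Manifold

/-- Euclidean three-space. -/
abbrev E3 : Type := EuclideanSpace ℝ (Fin 3)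

/-- The unit sphere `S²` in three-space. -/
abbrev S2 : Set E3 := Metric.sphere (0 : E3) 1

/-- The closed unit ball `B³` in three-space. -/
abbrev B3 : Set E3 := Metric.closedBall (0 : E3) 1

/-- The dimension of three-space, in the form in which the manifold structure of the unit sphere
looks it up. -/
instance factFinrankE3 : Fact (Module.finrank ℝ E3 = 2 + 1) :=
  ⟨by simp⟩

/-- `G` is a smooth orientation-preserving immersion of the closed ball `B³` into three-space:
it is smooth up to the boundary and its differential, which is an endomorphism of three-space,
has positive determinant (so it is injective and preserves orientation) at every point of `B³`,
boundary points included. Only the values of `G` on `B³` matter. -/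
structure IsOrientedBallImmersion (G : E3 → E3) : Prop where
  smooth : ContDiffOn ℝ ∞ G B3
  det_pos : ∀ x ∈ B3, 0 < (fderivWithin ℝ G B3 x).det

/-- `H : S² × [0,1] → ℝ³` is a null homotopy of `ι`: a continuous map that is `ι` at time `0`
and constant at time `1`. -/
structure IsNullHomotopy (ι : S2 → E3) (H : S2 × unitInterval → E3) : Prop where
  continuous : Continuous H
  initial : ∀ p, H (p, 0) = ι p
  terminal : ∃ c, ∀ p, H (p, 1) = c

/-- A null homotopy that is a Lipschitz map on `S² × [0,1]`. -/
structure IsLipschitzNullHomotopy (ι : S2 → E3) (H : S2 × unitInterval → E3) : Prop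
    extends IsNullHomotopy ι H where
  lipschitz : ∃ L : NNReal, LipschitzWith L H

/-- A map `S² × [0,1] → ℝ³` as a function of an ambient point and a real time: `extendHomotopy H x t` is
`H (x, t)` for `x ∈ S²` and `t ∈ [0,1]`, times outside `[0,1]` are moved to the nearest endpoint,
and the value is `0` off the sphere (it is only used on the sphere). -/
noncomputable def extendHomotopy (H : S2 × unitInterval → E3) (x : E3) (t : ℝ) : E3 :=
  open Classical in
  if hx : x ∈ S2 then H (⟨x, hx⟩, Set.projIcc 0 1 zero_le_one t) else 0

/-- The map `H` near `(p, t)`, `p ∈ S²`, read in the coordinates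
`x ↦ (x / ‖x‖, t + ‖x‖ - 1)`, which send a neighbourhood of `p` in `ℝ³` onto a neighbourhood
of `(p, t)` in `S² × ℝ`, and `p` to `(p, t)`. The differential of these coordinates at `p` is
`v + s • p ↦ (v, s)` for `v ⟂ p`, a linear isometry from `ℝ³` onto `T_p S² × ℝ`. -/
noncomputable def collarMap (H : S2 × unitInterval → E3) (t : ℝ) (x : E3) : E3 :=
  extendHomotopy H (‖x‖⁻¹ • x) (t + ‖x‖ - 1)

/-- The three-dimensional Jacobian `JH (p, t)` of `H`, that is, the absolute value of the
determinant of `dH : T_p S² × ℝ → ℝ³` with respect to orthonormal bases. Since the coordinates in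
`collarMap` have an isometric differential at `p`, it is the absolute value of the determinant of
the derivative of `collarMap H t` at `p`. -/
noncomputable def jacobian (H : S2 × unitInterval → E3) (q : S2 × unitInterval) : ℝ :=
  |(fderiv ℝ (collarMap H (q.2 : ℝ)) (q.1 : E3)).det|

/-- The swept volume: the integral of the Jacobian over `S² × [0,1]` with respect to the product
of the surface measure of the unit sphere and Lebesgue measure on `[0,1]`. -/
noncomputable def sweptVolume (H : S2 × unitInterval → E3) : ENNReal :=
  ∫⁻ q, ENNReal.ofReal (jacobian H q)
    ∂((volume : Measure E3).toSphere.prod (volume : Measure unitInterval))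

/-- The Brouwer degree `deg(f, Ω, y)` of a map that is smooth on the bounded open set `Ω` and
continuous on its closure, at a regular value `y` outside `f (∂Ω)`: the sum of the signs of the
determinants of the differential over the points of `Ω` that are mapped to `y`. (An immersion of
the closed ball has only regular values.) -/
noncomputable def brouwerDegree (f : E3 → E3) (Ω : Set E3) (y : E3) : ℤ :=
  ∑ᶠ x ∈ Ω ∩ f ⁻¹' {y}, ((SignType.sign (fderiv ℝ f x).det : SignType) : ℤ)

/-! Swept volume is the integral of the absolute value of a Jacobian determinant, so it is at least
the absolute value of the signed integral. The signed integral is the same for all Lipschitz null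
homotopies of `ι`. For the cone of `G` the determinant has constant sign, so the bound is attained
there. The area formula turns that integral into the integral of the number of preimages, which is
the degree because every sign is `+1`.

The invariance is `signedVolume_eq`. Each homotopy is read on the cone as a Lipschitz map of the
whole space, extended radially off the unit ball, so that any two such maps agree there. It remains
to see that `∫ det DF` over `B` depends only on `F` off `B` (`setIntegral_det_fderiv_congr`), which
needs neither Stokes nor smoothing. For small `r` the map `id + r F` is a bijection with positive
Jacobian, so `∫ det (1 + r DF)` over `B` is the volume of the image of `B`; that image is the
complement of the image of `Bᶜ`, which does not see `F` inside `B`. The integrand is a cubic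
polynomial in `r` with leading coefficient `det DF`, recovered by a finite difference at `±s` and
`±2s`. -/

/-! ### The integral of the Jacobian determinant as a boundary invariant -/

/-- The cubic coefficient of `s ↦ det (1 + s A)` as a finite difference. -/
theorem twelve_mul_cube_mul_det (A : E3 →L[ℝ] E3) (s : ℝ) :
    12 * s ^ 3 * A.det = (1 + (2 * s) • A).det - (1 + (-(2 * s)) • A).det
      - 2 * (1 + s • A).det + 2 * (1 + (-s) • A).det := by
  have key : ∀ C : E3 →L[ℝ] E3, C.det =
      (LinearMap.toMatrix (EuclideanSpace.basisFun (Fin 3) ℝ).toBasis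
        (EuclideanSpace.basisFun (Fin 3) ℝ).toBasis (C : E3 →ₗ[ℝ] E3)).det := fun C =>
    (LinearMap.det_toMatrix _ _).symm
  have key2 : ∀ s : ℝ, LinearMap.toMatrix (EuclideanSpace.basisFun (Fin 3) ℝ).toBasis
        (EuclideanSpace.basisFun (Fin 3) ℝ).toBasis ((1 + s • A : E3 →L[ℝ] E3) : E3 →ₗ[ℝ] E3) =
      1 + s • LinearMap.toMatrix (EuclideanSpace.basisFun (Fin 3) ℝ).toBasis
        (EuclideanSpace.basisFun (Fin 3) ℝ).toBasis (A : E3 →ₗ[ℝ] E3) := by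
    intro s
    rw [← LinearMap.toMatrix_one (EuclideanSpace.basisFun (Fin 3) ℝ).toBasis, ← map_smul, ← map_add]
    rfl
  simp only [key, key2]
  generalize LinearMap.toMatrix (EuclideanSpace.basisFun (Fin 3) ℝ).toBasis
        (EuclideanSpace.basisFun (Fin 3) ℝ).toBasis (A : E3 →ₗ[ℝ] E3) = M
  simp only [Matrix.det_fin_three, Matrix.add_apply, Matrix.smul_apply, smul_eq_mul]
  simp
  ring

theorem continuous_det_clm : Continuous fun A : E3 →L[ℝ] E3 => A.det :=
  ContinuousLinearMap.continuous_det

theorem exists_det_one_add_pos : ∃ δ > 0, ∀ A : E3 →L[ℝ] E3, ‖A‖ < δ → 0 < (1 + A).det := by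
  have h : Filter.Tendsto (fun A : E3 →L[ℝ] E3 => (1 + A).det) (nhds 0) (nhds 1) := by
    have := (continuous_det_clm.comp (continuous_const.add continuous_id :
      Continuous fun A : E3 →L[ℝ] E3 => 1 + A)).tendsto 0
    have h1 : (1 : E3 →L[ℝ] E3).det = 1 := LinearMap.det_id
    simpa [h1, Function.comp_def] using this
  obtain ⟨δ, hδ, H⟩ := Metric.eventually_nhds_iff.1 (h.eventually (lt_mem_nhds one_pos))
  exact ⟨δ, hδ, fun A hA => H (by simpa using hA)⟩

theorem exists_abs_det_le (L : ℝ) : ∃ C : ℝ, ∀ A : E3 →L[ℝ] E3, ‖A‖ ≤ L → |A.det| ≤ C := by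
  obtain ⟨C, hC⟩ := (isCompact_closedBall (0 : E3 →L[ℝ] E3) L).exists_bound_of_continuousOn
    continuous_det_clm.continuousOn
  exact ⟨C, fun A hA => hC A (by simpa using hA)⟩

/-- Lipschitz maps enlarge three-dimensional Hausdorff measure by at most a constant factor, and
this measure is a Haar measure, so it has the same null sets as volume. -/
theorem LipschitzWith.volume_image_eq_zero {F : E3 → E3} {L : NNReal} (hF : LipschitzWith L F)
    {N : Set E3} (hN : volume N = 0) : volume (F '' N) = 0 := by
  have h3 : (Measure.hausdorffMeasure (Module.finrank ℝ E3) : Measure E3).IsAddHaarMeasure :=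
    isAddHaarMeasure_hausdorffMeasure
  have h0 : (Measure.hausdorffMeasure (Module.finrank ℝ E3) : Measure E3) N = 0 :=
    Measure.absolutelyContinuous_isAddHaarMeasure _ volume hN
  refine Measure.absolutelyContinuous_isAddHaarMeasure volume
    (Measure.hausdorffMeasure (Module.finrank ℝ E3) : Measure E3) ?_
  refine le_antisymm ((hF.lipschitzOnWith.hausdorffMeasure_image_le (by positivity)).trans ?_) zero_le
  rw [h0, mul_zero]

theorem measurable_det_fderiv (F : E3 → E3) : Measurable fun x => (fderiv ℝ F x).det :=
  continuous_det_clm.measurable.comp (measurable_fderiv ℝ F)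

theorem integrableOn_det_of_norm_le {A : E3 → E3 →L[ℝ] E3} (hA : Measurable A) {L : ℝ}
    {B : Set E3} (hm : MeasurableSet B) (hL : ∀ x ∈ B, ‖A x‖ ≤ L) (hB : volume B ≠ ⊤) :
    IntegrableOn (fun x => (A x).det) B := by
  obtain ⟨C, hC⟩ := exists_abs_det_le L
  refine Measure.integrableOn_of_bounded hB
    (continuous_det_clm.measurable.comp hA).aestronglyMeasurable (M := C) ?_
  exact (ae_restrict_iff' hm).2 (.of_forall fun x hx => hC _ (hL x hx))

/-- Solving `x + s F x = y` means finding a fixed point of `x ↦ y - s F x`, which is a contraction.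
-/
theorem bijective_id_add_smul {F : E3 → E3} {L : NNReal} (hF : LipschitzWith L F) {s : ℝ}
    (hs : |s| * L < 1) : Function.Bijective fun x => x + s • F x := by
  have hlip : ∀ y : E3, LipschitzWith (‖s‖₊ * L) fun x => y - s • F x := by
    intro y
    refine LipschitzWith.of_dist_le_mul fun a b => ?_
    rw [dist_sub_left, dist_smul₀]
    have := hF.dist_le_mul a b
    simp only [NNReal.coe_mul, coe_nnnorm, mul_assoc]
    gcongr
  have hc : ∀ y : E3, ContractingWith (‖s‖₊ * L) fun x => y - s • F x := fun y =>
    ⟨by rw [← NNReal.coe_lt_coe]; simpa using hs, hlip y⟩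
  constructor
  · intro a b hab
    have hab : a + s • F a = b + s • F b := hab
    refine (hc (a + s • F a)).fixedPoint_unique' (x := a) (y := b) ?_ ?_
    · simp [Function.IsFixedPt]
    · simp [Function.IsFixedPt, hab]
  · intro y
    refine ⟨(hc y).fixedPoint, ?_⟩
    have : y - s • F (hc y).fixedPoint = (hc y).fixedPoint := (hc y).fixedPoint_isFixedPt
    exact (sub_eq_iff_eq_add.1 this).symm

theorem image_eq_of_eqOn_compl {α β : Type*} {f g : α → β} (hf : f.Bijective) (hg : g.Bijective)
    {B : Set α} (h : Set.EqOn f g Bᶜ) : f '' B = g '' B := by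
  have h1 := Set.image_compl_eq (s := Bᶜ) hf
  have h2 := Set.image_compl_eq (s := Bᶜ) hg
  rw [compl_compl] at h1 h2
  rw [h1, h2, h.image_eq]

/-- Change of variables on the points of differentiability. The remaining points form a null set by
Rademacher's theorem and have null image. Positivity of the determinant removes the absolute value.
-/
theorem integral_det_one_add_smul_fderiv {F : E3 → E3} {L : NNReal} (hF : LipschitzWith L F)
    {δ : ℝ} (hδ : ∀ A : E3 →L[ℝ] E3, ‖A‖ < δ → 0 < (1 + A).det) {s : ℝ}
    (hs : |s| * L < 1) (hs' : |s| * L < δ) {B : Set E3} (hB : MeasurableSet B) :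
    ∫ x in B, (1 + s • fderiv ℝ F x).det = volume.real ((fun x => x + s • F x) '' B) := by
  set D : Set E3 := {x | DifferentiableAt ℝ F x}
  have hD : MeasurableSet D := measurableSet_of_differentiableAt ℝ F
  have hN : volume (Dᶜ) = 0 := hF.ae_differentiableAt (μ := volume)
  have hinj := (bijective_id_add_smul hF hs).1
  have hlip : LipschitzWith (1 + ‖s‖₊ * L) fun x => x + s • F x :=
    LipschitzWith.id.add ((lipschitzWith_smul s).comp hF)
  have h1 := lintegral_abs_det_fderiv_eq_addHaar_image volume (hB.inter hD)
    (f := fun x => x + s • F x) (f' := fun x => 1 + s • fderiv ℝ F x)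
    (fun x hx => ((hasFDerivAt_id x).add (hx.2.hasFDerivAt.const_smul s)).hasFDerivWithinAt)
    hinj.injOn
  have h2 : volume ((fun x => x + s • F x) '' (B ∩ D)) = volume ((fun x => x + s • F x) '' B) := by
    refine le_antisymm (measure_mono (Set.image_mono Set.inter_subset_left)) ?_
    calc volume ((fun x => x + s • F x) '' B)
        ≤ volume ((fun x => x + s • F x) '' (B ∩ D) ∪ (fun x => x + s • F x) '' Dᶜ) := by
          refine measure_mono ?_
          rw [← Set.image_union]
          refine Set.image_mono fun x hx => ?_
          by_cases h : x ∈ D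
          · exact .inl ⟨hx, h⟩
          · exact .inr h
      _ ≤ _ := measure_union_le _ _
      _ = _ := by rw [hlip.volume_image_eq_zero hN, add_zero]
  have h3 : (B ∩ D : Set E3) =ᵐ[volume] B :=
    inter_ae_eq_left_of_ae_eq_univ (ae_eq_univ.2 hN)
  have hpos : ∀ x, 0 < (1 + s • fderiv ℝ F x).det := fun x => hδ _ (by
    rw [norm_smul]
    refine lt_of_le_of_lt ?_ hs'
    exact mul_le_mul_of_nonneg_left (norm_fderiv_le_of_lipschitz ℝ hF) (abs_nonneg s))
  rw [setLIntegral_congr h3, h2] at h1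
  rw [Measure.real, ← h1, integral_eq_lintegral_of_nonneg_ae (.of_forall fun x => (hpos x).le)]
  · simp only [abs_of_pos (hpos _)]
  · exact (continuous_det_clm.measurable.comp
      ((measurable_fderiv ℝ F).const_smul s |>.const_add 1)).aestronglyMeasurable

/-- The integral of the Jacobian determinant depends only on the boundary values. -/
theorem setIntegral_det_fderiv_congr {F G : E3 → E3} {L L' : NNReal} (hF : LipschitzWith L F)
    (hG : LipschitzWith L' G) {B : Set E3} (hB : MeasurableSet B) (hfin : volume B ≠ ⊤)
    (hFG : Set.EqOn F G Bᶜ) :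
    ∫ x in B, (fderiv ℝ F x).det = ∫ x in B, (fderiv ℝ G x).det := by
  obtain ⟨δ, hδ, H⟩ := exists_det_one_add_pos
  -- The factor `2` makes all four nodes `±s`, `±2s` of the finite difference small enough for both
  -- bijectivity and positivity.
  obtain ⟨s, hs0, hs⟩ : ∃ s : ℝ, 0 < s ∧ 2 * s * (max L L' : NNReal) < min 1 δ := by
    have hm : 0 < min 1 δ := lt_min one_pos hδ
    refine ⟨min 1 δ / (2 * ((max L L' : NNReal) + 1)), by positivity, ?_⟩
    have : (0 : ℝ) ≤ (max L L' : NNReal) := NNReal.coe_nonneg _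
    rw [mul_div_assoc', div_mul_eq_mul_div, div_lt_iff₀ (by positivity)]
    nlinarith
  have hF := hF.weaken (le_max_left L L')
  have hG := hG.weaken (le_max_right L L')
  generalize max L L' = M at *
  have key : ∀ r : ℝ, |r| ≤ 2 * s → ∫ x in B, (1 + r • fderiv ℝ F x).det =
      ∫ x in B, (1 + r • fderiv ℝ G x).det := by
    intro r hr
    have h0 : |r| * M < min 1 δ := lt_of_le_of_lt (by gcongr) hs
    have h1 := h0.trans_le (min_le_left _ _)
    have h2 := h0.trans_le (min_le_right _ _)
    rw [integral_det_one_add_smul_fderiv hF H h1 h2 hB,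
      integral_det_one_add_smul_fderiv hG H h1 h2 hB,
      image_eq_of_eqOn_compl (bijective_id_add_smul hF h1) (bijective_id_add_smul hG h1)
        (fun x hx => by simp only [hFG hx])]
  have expand : ∀ {F : E3 → E3}, LipschitzWith M F → 12 * s ^ 3 * ∫ x in B, (fderiv ℝ F x).det =
      (∫ x in B, (1 + (2 * s) • fderiv ℝ F x).det) - (∫ x in B, (1 + (-(2 * s)) • fderiv ℝ F x).det)
      - 2 * (∫ x in B, (1 + s • fderiv ℝ F x).det)
      + 2 * ∫ x in B, (1 + (-s) • fderiv ℝ F x).det := by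
    intro F hF
    have hi : ∀ r : ℝ, IntegrableOn (fun x => (1 + r • fderiv ℝ F x).det) B := fun r =>
      integrableOn_det_of_norm_le ((measurable_fderiv ℝ F).const_smul r |>.const_add 1)
        (L := ‖(1 : E3 →L[ℝ] E3)‖ + |r| * M) hB (fun x _ => (norm_add_le _ _).trans (by
          rw [Pi.smul_apply, norm_smul, Real.norm_eq_abs]
          gcongr
          · exact norm_fderiv_le_of_lipschitz ℝ hF)) hfin
    have lin : ∀ {f₁ f₂ f₃ f₄ : E3 → ℝ}, IntegrableOn f₁ B → IntegrableOn f₂ B →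
        IntegrableOn f₃ B → IntegrableOn f₄ B →
        ∫ x in B, (f₁ x - f₂ x - 2 * f₃ x + 2 * f₄ x) =
          (∫ x in B, f₁ x) - (∫ x in B, f₂ x) - 2 * (∫ x in B, f₃ x) + 2 * ∫ x in B, f₄ x := by
      intro f₁ f₂ f₃ f₄ h₁ h₂ h₃ h₄
      rw [integral_add (f := fun x => f₁ x - f₂ x - 2 * f₃ x) ((h₁.sub h₂).sub (h₃.const_mul 2)) (h₄.const_mul 2),
        integral_sub (f := fun x => f₁ x - f₂ x) (h₁.sub h₂) (h₃.const_mul 2), integral_sub h₁ h₂,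
        integral_const_mul, integral_const_mul]
    rw [← lin (hi _) (hi _) (hi _) (hi _), ← integral_const_mul]
    simp only [twelve_mul_cube_mul_det]
  have h12 : 12 * s ^ 3 ≠ 0 := by positivity
  refine mul_left_cancel₀ h12 ?_
  rw [expand hF, expand hG]
  have hs2 : s ≤ 2 * s := by linarith
  rw [key (2 * s) (by rw [abs_of_pos (by positivity)]),
    key (-(2 * s)) (by rw [abs_neg, abs_of_pos (by positivity)]),
    key s (by rwa [abs_of_pos hs0]), key (-s) (by rwa [abs_neg, abs_of_pos hs0])]

/-! ### Polar coordinates on spherical shells -/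

theorem lintegral_eq_lintegral_toSphere {g : E3 → ENNReal} (hg : Measurable g) :
    ∫⁻ x, g x = ∫⁻ p, (∫⁻ r in Set.Ioi (0 : ℝ), ENNReal.ofReal (r ^ 2) * g (r • (p : E3)))
      ∂(volume : Measure E3).toSphere := by
  have hdim : Module.finrank ℝ E3 - 1 = 2 := by simp
  have h := (volume : Measure E3).measurePreserving_homeomorphUnitSphereProd
  rw [hdim] at h
  have hm : Measurable fun q : S2 × Set.Ioi (0 : ℝ) => g ((q.2 : ℝ) • (q.1 : E3)) :=
    hg.comp (by fun_prop)
  calc ∫⁻ x, g x = ∫⁻ x in ({0}ᶜ : Set E3), g x := by rw [restrict_compl_singleton]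
    _ = ∫⁻ x : ({0}ᶜ : Set E3), g x ∂(volume : Measure E3).comap Subtype.val :=
        (lintegral_subtype_comap (measurableSet_singleton _).compl _).symm
    _ = ∫⁻ x : ({0}ᶜ : Set E3), g (((homeomorphUnitSphereProd E3 x).2 : ℝ) •
          ((homeomorphUnitSphereProd E3 x).1 : E3)) ∂(volume : Measure E3).comap Subtype.val := by
        refine lintegral_congr fun x => ?_
        have hx : ‖(x : E3)‖ ≠ 0 := norm_ne_zero_iff.2 x.2
        simp [smul_smul, hx]
    _ = _ := h.lintegral_comp hm
    _ = _ := by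
        rw [lintegral_prod _ hm.aemeasurable]
        refine lintegral_congr fun p => ?_
        have hm' : Measurable fun r : ℝ => g (r • (p : E3)) := hg.comp (by fun_prop)
        rw [Measure.volumeIoiPow, lintegral_withDensity_eq_lintegral_mul _ (by fun_prop)
          (g := fun r : Set.Ioi (0 : ℝ) => g ((r : ℝ) • (p : E3)))
          (hm'.comp measurable_subtype_coe)]
        exact lintegral_subtype_comap measurableSet_Ioi
          (fun r => ENNReal.ofReal (r ^ 2) * g (r • (p : E3)))

theorem lintegral_unitInterval (g : ℝ → ENNReal) :
    ∫⁻ t : unitInterval, g t = ∫⁻ t in Set.Ioo (0 : ℝ) 1, g t := by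
  rw [setLIntegral_congr Ioo_ae_eq_Icc]
  exact lintegral_subtype_comap measurableSet_Icc g

/-- The open spherical shell between the radii `1 - b` and `1`. -/
def shell (b : ℝ) : Set E3 := Metric.ball 0 1 \ Metric.closedBall 0 (1 - b)

theorem measurableSet_shell (b : ℝ) : MeasurableSet (shell b) :=
  measurableSet_ball.diff measurableSet_closedBall

/-- The parametrization of the shell by `S² × [0,1]`, starting at the unit sphere. -/
def shellMap (b : ℝ) (q : S2 × unitInterval) : E3 := (1 - b * (q.2 : ℝ)) • (q.1 : E3)

/-- The Jacobian of `shellMap b`. -/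
noncomputable def shellDensity (b : ℝ) (q : S2 × unitInterval) : ℝ := b * (1 - b * (q.2 : ℝ)) ^ 2

/-- The product of the surface measure and Lebesgue measure. -/
noncomputable def cylinderMeasure : Measure (S2 × unitInterval) :=
  (volume : Measure E3).toSphere.prod (volume : Measure unitInterval)

instance : SFinite cylinderMeasure := by unfold cylinderMeasure; infer_instance

theorem measurable_shellDensity (b : ℝ) : Measurable (shellDensity b) := by
  unfold shellDensity; fun_prop

theorem measurable_shellMap (b : ℝ) : Measurable (shellMap b) := by
  unfold shellMap; fun_prop

theorem image_one_sub_mul_Ioo {b : ℝ} (hb : 0 < b) :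
    (fun t : ℝ => 1 - b * t) '' Set.Ioo 0 1 = Set.Ioo (1 - b) 1 := by
  ext r
  constructor
  · rintro ⟨t, ⟨h0, h1⟩, rfl⟩
    constructor <;> nlinarith
  · rintro ⟨h0, h1⟩
    refine ⟨(1 - r) / b, ⟨by apply div_pos <;> linarith, ?_⟩, by field_simp; ring⟩
    rw [div_lt_one hb]; linarith

/-- This is polar integration after the substitution `r = 1 - b t`: the weight `r ^ 2` and the
factor `|-b|` make up the density. -/
theorem measurePreserving_shellMap {b : ℝ} (hb : 0 < b) (hb1 : b ≤ 1) :
    MeasurePreserving (shellMap b)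
      (cylinderMeasure.withDensity fun q => ENNReal.ofReal (shellDensity b q))
      (volume.restrict (shell b)) := by
  refine ⟨measurable_shellMap b, ?_⟩
  ext s hs
  rw [Measure.map_apply (measurable_shellMap b) hs, Measure.restrict_apply hs,
    withDensity_apply _ ((measurable_shellMap b) hs),
    ← lintegral_indicator ((measurable_shellMap b) hs),
    ← lintegral_indicator_one (hs.inter (measurableSet_shell b)),
    lintegral_eq_lintegral_toSphere (measurable_one.indicator (hs.inter (measurableSet_shell b))),
    cylinderMeasure, lintegral_prod]
  swap
  · exact ((measurable_shellDensity b).ennreal_ofReal.indicator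
      ((measurable_shellMap b) hs)).aemeasurable
  refine lintegral_congr fun p => ?_
  have hp : ‖(p : E3)‖ = 1 := by simp
  have hL := lintegral_unitInterval fun t => ENNReal.ofReal |(-b)| *
    (ENNReal.ofReal ((1 - b * t) ^ 2) * s.indicator 1 ((1 - b * t) • (p : E3)))
  have hder : ∀ t ∈ Set.Ioo (0 : ℝ) 1,
      HasDerivWithinAt (fun t : ℝ => 1 - b * t) (-b) (Set.Ioo 0 1) t := by
    intro t _
    simpa using (((hasDerivAt_id t).const_mul b).const_sub 1).hasDerivWithinAt
  have hR := lintegral_image_eq_lintegral_abs_deriv_mul (f := fun t : ℝ => 1 - b * t)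
    (f' := fun _ => -b) (s := Set.Ioo (0 : ℝ) 1) measurableSet_Ioo hder
    (fun x _ y _ h => by
      have h : 1 - b * x = 1 - b * y := h
      exact mul_left_cancel₀ hb.ne' (by linarith))
    (fun r => ENNReal.ofReal (r ^ 2) * s.indicator 1 (r • (p : E3)))
  rw [image_one_sub_mul_Ioo hb] at hR
  trans ∫⁻ r in Set.Ioo (1 - b) 1, ENNReal.ofReal (r ^ 2) * s.indicator 1 (r • (p : E3))
  · rw [hR, ← hL]
    refine lintegral_congr fun t => ?_
    by_cases h : shellMap b (p, t) ∈ s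
    · rw [Set.indicator_of_mem (by exact h), Set.indicator_of_mem (by exact h), abs_neg,
        abs_of_pos hb, Pi.one_apply, mul_one, ← ENNReal.ofReal_mul hb.le]
      rfl
    · rw [Set.indicator_of_notMem (by exact h), Set.indicator_of_notMem (by exact h), mul_zero,
        mul_zero]
  · rw [← lintegral_indicator measurableSet_Ioo, ← lintegral_indicator measurableSet_Ioi]
    refine lintegral_congr fun r => ?_
    by_cases hr : 0 < r
    · rw [Set.indicator_of_mem (s := Set.Ioi 0) hr]
      have hmem : r • (p : E3) ∈ shell b ↔ r ∈ Set.Ioo (1 - b) 1 := by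
        simp [shell, norm_smul, hp, abs_of_pos hr, and_comm]
      by_cases h : r ∈ Set.Ioo (1 - b) 1
      · rw [Set.indicator_of_mem h]
        by_cases h' : r • (p : E3) ∈ s
        · rw [Set.indicator_of_mem h', Set.indicator_of_mem (Set.mem_inter h' (hmem.2 h))]
        · rw [Set.indicator_of_notMem h', Set.indicator_of_notMem fun H => h' H.1]
      · rw [Set.indicator_of_notMem h, Set.indicator_of_notMem fun H => h (hmem.1 H.2), mul_zero]
    · rw [Set.indicator_of_notMem (s := Set.Ioi 0) (by simpa using hr),
        Set.indicator_of_notMem fun H => hr (by have := H.1; linarith)]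

theorem ae_cylinderMeasure_time_mem_Ioo :
    ∀ᵐ q ∂cylinderMeasure, (q.2 : ℝ) ∈ Set.Ioo (0 : ℝ) 1 := by
  have h : ∀ᵐ t : unitInterval, (t : ℝ) ∈ Set.Ioo (0 : ℝ) 1 := by
    have h0 : ∀ᵐ t : unitInterval, t ≠ 0 := by
      rw [ae_iff]; simp
    have h1 : ∀ᵐ t : unitInterval, t ≠ 1 := by
      rw [ae_iff]; simp
    filter_upwards [h0, h1] with t h0 h1
    exact ⟨unitInterval.pos_iff_ne_zero.2 h0, unitInterval.lt_one_iff_ne_one.2 h1⟩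
  exact Measure.quasiMeasurePreserving_snd.ae h

theorem shellDensity_pos {b : ℝ} (hb : 0 < b) (hb1 : b ≤ 1) {q : S2 × unitInterval}
    (hq : (q.2 : ℝ) ∈ Set.Ioo (0 : ℝ) 1) : 0 < shellDensity b q := by
  have : 0 < 1 - b * (q.2 : ℝ) := by nlinarith [hq.1, hq.2]
  unfold shellDensity; positivity

/-- The density is positive at interior times, so a null set in the shell pulls back to a null set
of the unweighted cylinder. -/
theorem ae_cylinderMeasure_shellMap {b : ℝ} (hb : 0 < b) (hb1 : b ≤ 1) {P : E3 → Prop}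
    (h : ∀ᵐ x, x ∈ shell b → P x) : ∀ᵐ q ∂cylinderMeasure, P (shellMap b q) := by
  have h1 := (measurePreserving_shellMap hb hb1).quasiMeasurePreserving.ae
    ((ae_restrict_iff' (measurableSet_shell b)).2 h)
  rw [ae_withDensity_iff (measurable_shellDensity b).ennreal_ofReal] at h1
  filter_upwards [h1, ae_cylinderMeasure_time_mem_Ioo] with q h2 h3
  exact h2 (by simpa using shellDensity_pos hb hb1 h3)

theorem lintegral_cylinderMeasure_shellMap {b : ℝ} (hb : 0 < b) (hb1 : b ≤ 1) {g : E3 → ENNReal}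
    (hg : Measurable g) :
    ∫⁻ q, ENNReal.ofReal (shellDensity b q) * g (shellMap b q) ∂cylinderMeasure =
      ∫⁻ x in shell b, g x := by
  rw [← (measurePreserving_shellMap hb hb1).lintegral_comp hg,
    lintegral_withDensity_eq_lintegral_mul _ (measurable_shellDensity b).ennreal_ofReal
      (g := fun q => g (shellMap b q)) (hg.comp (measurable_shellMap b))]
  rfl

theorem integral_cylinderMeasure_shellMap {b : ℝ} (hb : 0 < b) (hb1 : b ≤ 1) {g : E3 → ℝ}
    (hg : Measurable g) :
    ∫ q, shellDensity b q * g (shellMap b q) ∂cylinderMeasure = ∫ x in shell b, g x := by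
  rw [← (measurePreserving_shellMap hb hb1).map_eq, integral_map
    (measurable_shellMap b).aemeasurable hg.aestronglyMeasurable,
    integral_withDensity_eq_integral_toReal_smul (measurable_shellDensity b).ennreal_ofReal
      (.of_forall fun _ => ENNReal.ofReal_lt_top)]
  refine integral_congr_ae (.of_forall fun q => ?_)
  have : 0 ≤ shellDensity b q := by unfold shellDensity; positivity
  simp [ENNReal.toReal_ofReal this]

/-! ### The Jacobian in collar coordinates -/

/-- The operator is multiplication by `c` on the plane orthogonal to `p` and by `c - a` on the line
of `p`. -/
theorem det_smul_id_sub_smul_innerSL (c a : ℝ) (p : E3) (hp : ‖p‖ = 1) :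
    (c • (1 : E3 →L[ℝ] E3) - a • (innerSL ℝ p).smulRight p).det = c ^ 2 * (c - a) := by
  set b := (EuclideanSpace.basisFun (Fin 3) ℝ).toBasis
  have h1 : (c • (1 : E3 →L[ℝ] E3) - a • (innerSL ℝ p).smulRight p).det =
      (LinearMap.toMatrix b b
        ((c • (1 : E3 →L[ℝ] E3) - a • (innerSL ℝ p).smulRight p : E3 →L[ℝ] E3) : E3 →ₗ[ℝ] E3)).det :=
    (LinearMap.det_toMatrix _ _).symm
  have h2 : LinearMap.toMatrix b b
        ((c • (1 : E3 →L[ℝ] E3) - a • (innerSL ℝ p).smulRight p : E3 →L[ℝ] E3) : E3 →ₗ[ℝ] E3) =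
      c • (1 : Matrix (Fin 3) (Fin 3) ℝ) - a • Matrix.of fun i j => p j * p i := by
    ext i j
    simp [b, LinearMap.toMatrix_apply, Matrix.one_apply, EuclideanSpace.inner_single_right]
  have h3 : p 0 ^ 2 + p 1 ^ 2 + p 2 ^ 2 = 1 := by
    have := EuclideanSpace.real_norm_sq_eq p
    rw [hp, Fin.sum_univ_three] at this
    linarith
  rw [h1, h2, Matrix.det_fin_three]
  simp
  linear_combination (-a * c ^ 2) * h3

/-- The derivative at a unit vector `p` of the radial map `x ↦ (a / ‖x‖ - b) • x`. -/
theorem hasFDerivAt_radial (a b : ℝ) (p : E3) (hp : ‖p‖ = 1) :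
    HasFDerivAt (fun x : E3 => (a * ‖x‖⁻¹ - b) • x)
      ((a - b) • (1 : E3 →L[ℝ] E3) - a • (innerSL ℝ p).smulRight p) p := by
  have hp0 : p ≠ 0 := by rintro rfl; simp at hp
  have hn : HasFDerivAt (fun x : E3 => ‖x‖) (innerSL ℝ p) p := by
    have := (hasStrictFDerivAt_norm_sq p).hasFDerivAt.sqrt (by simp [hp])
    simp only [Real.sqrt_sq (norm_nonneg _), hp] at this
    have e : (1 / (2 * Real.sqrt (1 ^ 2))) • 2 • innerSL ℝ p = innerSL ℝ p := by
      ext v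
      simp
    rw [e] at this
    exact this
  have hi : HasFDerivAt (fun x : E3 => ‖x‖⁻¹) (-innerSL ℝ p) p := by
    have := (hasDerivAt_inv (x := ‖p‖) (by simp [hp])).comp_hasFDerivAt p hn
    have e : (-(‖p‖ ^ 2)⁻¹) • innerSL ℝ p = -innerSL ℝ p := by
      ext v
      simp [hp]
    rw [e] at this
    exact this
  have := ((hi.const_mul a).sub_const b).smul (hasFDerivAt_id p)
  refine this.congr_fderiv ?_
  ext v i
  simp [hp]
  ring

/-- If `K` is `F` read on a shell, then so is the collar map of `K`, up to a radial map. -/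
theorem collarMap_eventuallyEq {F : E3 → E3} {K : S2 × unitInterval → E3} {b : ℝ}
    (hK : ∀ p t, K (p, t) = F ((1 - b * (t : ℝ)) • (p : E3))) {q : S2 × unitInterval}
    (hq : (q.2 : ℝ) ∈ Set.Ioo (0 : ℝ) 1) :
    collarMap K (q.2 : ℝ) =ᶠ[nhds (q.1 : E3)]
      F ∘ fun x : E3 => ((1 - b * (q.2 : ℝ) + b) * ‖x‖⁻¹ - b) • x := by
  obtain ⟨p, t⟩ := q
  have hp : ‖(p : E3)‖ = 1 := by simp
  have hp0 : (p : E3) ≠ 0 := by intro h; simp [h] at hp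
  have hc : ContinuousAt (fun x : E3 => (t : ℝ) + ‖x‖ - 1) (p : E3) := by fun_prop
  -- Near `p` the collar time stays strictly inside `[0,1]`, where clamping by `projIcc` has no
  -- effect.
  have hIoo : ∀ᶠ x in nhds (p : E3), (t : ℝ) + ‖x‖ - 1 ∈ Set.Ioo (0 : ℝ) 1 :=
    hc.eventually_mem (Ioo_mem_nhds (by simpa [hp] using hq.1) (by simpa [hp] using hq.2))
  filter_upwards [hIoo, eventually_ne_nhds hp0] with x hx hx0
  have hn : ‖x‖ ≠ 0 := norm_ne_zero_iff.2 hx0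
  have hmem : ‖x‖⁻¹ • x ∈ S2 := by simp [norm_smul, hn]
  rw [collarMap, extendHomotopy, dif_pos hmem, hK,
    Set.projIcc_of_mem zero_le_one ⟨hx.1.le, hx.2.le⟩, Function.comp_apply, smul_smul]
  congr 2
  field_simp
  ring

/-- The radial map has tangential factor `1 - b t` and radial factor `-b`. The minus sign appears
because increasing time moves inwards along the radius. -/
theorem det_fderiv_collarMap {F : E3 → E3} {K : S2 × unitInterval → E3} {b : ℝ}
    (hK : ∀ p t, K (p, t) = F ((1 - b * (t : ℝ)) • (p : E3))) {q : S2 × unitInterval}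
    (hq : (q.2 : ℝ) ∈ Set.Ioo (0 : ℝ) 1) (hF : DifferentiableAt ℝ F (shellMap b q)) :
    (fderiv ℝ (collarMap K (q.2 : ℝ)) (q.1 : E3)).det =
      -(shellDensity b q * (fderiv ℝ F (shellMap b q)).det) := by
  have hp : ‖(q.1 : E3)‖ = 1 := by simp
  have hr := hasFDerivAt_radial (1 - b * (q.2 : ℝ) + b) b q.1 hp
  have hval : ((1 - b * (q.2 : ℝ) + b) * ‖(q.1 : E3)‖⁻¹ - b) • (q.1 : E3) = shellMap b q := by
    rw [hp, shellMap]; congr 1; ring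
  have hF' : HasFDerivAt F (fderiv ℝ F (shellMap b q))
      (((1 - b * (q.2 : ℝ) + b) * ‖(q.1 : E3)‖⁻¹ - b) • (q.1 : E3)) := by
    rw [hval]; exact hF.hasFDerivAt
  have h := (HasFDerivAt.comp (f := fun x : E3 => ((1 - b * (q.2 : ℝ) + b) * ‖x‖⁻¹ - b) • x)
    (q.1 : E3) hF' hr).congr_of_eventuallyEq (collarMap_eventuallyEq hK hq)
  rw [h.fderiv]
  have hmul : ∀ A B : E3 →L[ℝ] E3, (A ∘L B).det = A.det * B.det := fun A B =>
    LinearMap.det_comp (A : E3 →ₗ[ℝ] E3) (B : E3 →ₗ[ℝ] E3)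
  rw [hmul, det_smul_id_sub_smul_innerSL _ _ _ hp, shellDensity]
  ring

theorem sweptVolume_eq_lintegral_shell {F : E3 → E3} {K : S2 × unitInterval → E3} {b : ℝ}
    (hb : 0 < b) (hb1 : b ≤ 1)
    (hK : ∀ p t, K (p, t) = F ((1 - b * (t : ℝ)) • (p : E3)))
    (hF : ∀ᵐ x, x ∈ shell b → DifferentiableAt ℝ F x) :
    sweptVolume K = ∫⁻ x in shell b, ENNReal.ofReal |(fderiv ℝ F x).det| := by
  rw [← lintegral_cylinderMeasure_shellMap hb hb1 (measurable_det_fderiv F).abs.ennreal_ofReal]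
  refine lintegral_congr_ae ?_
  filter_upwards [ae_cylinderMeasure_shellMap hb hb1 hF, ae_cylinderMeasure_time_mem_Ioo]
    with q h1 h2
  have h3 := shellDensity_pos hb hb1 h2
  rw [jacobian, det_fderiv_collarMap hK h2 h1, abs_neg, abs_mul, abs_of_pos h3,
    ENNReal.ofReal_mul h3.le]

/-- The integral of the signed Jacobian of `K` over `S² × [0,1]`. -/
noncomputable def signedVolume (K : S2 × unitInterval → E3) : ℝ :=
  ∫ q, (fderiv ℝ (collarMap K (q.2 : ℝ)) (q.1 : E3)).det ∂cylinderMeasure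

theorem signedVolume_eq_integral_shell {F : E3 → E3} {K : S2 × unitInterval → E3} {b : ℝ}
    (hb : 0 < b) (hb1 : b ≤ 1)
    (hK : ∀ p t, K (p, t) = F ((1 - b * (t : ℝ)) • (p : E3)))
    (hF : ∀ᵐ x, x ∈ shell b → DifferentiableAt ℝ F x) :
    signedVolume K = -∫ x in shell b, (fderiv ℝ F x).det := by
  rw [← integral_cylinderMeasure_shellMap hb hb1 (measurable_det_fderiv F), ← integral_neg]
  refine integral_congr_ae ?_
  filter_upwards [ae_cylinderMeasure_shellMap hb hb1 hF, ae_cylinderMeasure_time_mem_Ioo]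
    with q h1 h2
  rw [det_fderiv_collarMap hK h2 h1]

/-- No integrability is required: the integral of a non-integrable function is `0` by convention. -/
theorem ofReal_abs_signedVolume_le_sweptVolume (K : S2 × unitInterval → E3) :
    ENNReal.ofReal |signedVolume K| ≤ sweptVolume K := by
  have := enorm_integral_le_lintegral_enorm (μ := cylinderMeasure)
    fun q : S2 × unitInterval => (fderiv ℝ (collarMap K (q.2 : ℝ)) (q.1 : E3)).det
  simp only [Real.enorm_eq_ofReal_abs] at this
  exact this

/-! ### Lipschitz null homotopies read on the cone -/

/-- The radial projection to the unit sphere, with an arbitrary value at the origin. -/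
noncomputable def direction (x : E3) : S2 :=
  open Classical in
  if hx : x = 0 then ⟨EuclideanSpace.single 0 1, by simp⟩
  else ⟨‖x‖⁻¹ • x, by simp [norm_smul, norm_ne_zero_iff.2 hx]⟩

theorem coe_direction {x : E3} (hx : x ≠ 0) : (direction x : E3) = ‖x‖⁻¹ • x := by
  simp [direction, hx]

theorem direction_smul (p : S2) {r : ℝ} (hr : 0 < r) : direction (r • (p : E3)) = p := by
  have hp : ‖(p : E3)‖ = 1 := by simp
  have hp0 : (p : E3) ≠ 0 := by intro h; simp [h] at hp
  refine Subtype.ext ?_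
  rw [coe_direction (smul_ne_zero hr.ne' hp0), norm_smul, hp, Real.norm_of_nonneg hr.le, mul_one,
    smul_smul, inv_mul_cancel₀ hr.ne', one_smul]

/-- Changing first the vector and then the normalizing factor gives two errors, each at most `‖x‖⁻¹
≤ 2` times the distance. -/
theorem dist_direction_le {x y : E3} (hx : 1 / 2 ≤ ‖x‖) (hy : y ≠ 0) :
    dist (direction x) (direction y) ≤ 4 * dist x y := by
  have hx0 : 0 < ‖x‖ := by linarith
  have hy0 : 0 < ‖y‖ := norm_pos_iff.2 hy
  rw [Subtype.dist_eq, coe_direction (norm_pos_iff.1 hx0), coe_direction hy, dist_eq_norm,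
    dist_eq_norm]
  have e : ‖x‖⁻¹ • x - ‖y‖⁻¹ • y = ‖x‖⁻¹ • (x - y) + (‖x‖⁻¹ - ‖y‖⁻¹) • y := by
    rw [smul_sub, sub_smul]; abel
  have h1 : |‖x‖⁻¹ - ‖y‖⁻¹| * ‖y‖ = ‖x‖⁻¹ * |‖y‖ - ‖x‖| := by
    rw [inv_sub_inv hx0.ne' hy0.ne', abs_div, abs_of_pos (mul_pos hx0 hy0)]
    field_simp
  have h2 : |‖y‖ - ‖x‖| ≤ ‖x - y‖ := by
    rw [norm_sub_rev]; exact abs_norm_sub_norm_le y x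
  have h3 : ‖x‖⁻¹ ≤ 2 := by
    rw [inv_le_comm₀ hx0 two_pos]; linarith
  calc ‖‖x‖⁻¹ • x - ‖y‖⁻¹ • y‖ ≤ ‖x‖⁻¹ * ‖x - y‖ + |‖x‖⁻¹ - ‖y‖⁻¹| * ‖y‖ := by
        rw [e]
        refine (norm_add_le _ _).trans ?_
        rw [norm_smul, norm_smul, Real.norm_eq_abs, Real.norm_eq_abs, abs_of_pos (inv_pos.2 hx0)]
    _ ≤ 2 * ‖x - y‖ + 2 * ‖x - y‖ := by
        rw [h1]; gcongr
    _ = _ := by ring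

/-- The time at which the cone point `x` is reached: `0` off the unit ball and `1` on the ball of
radius `1 / 2`. -/
noncomputable def coneTime (x : E3) : unitInterval := Set.projIcc 0 1 zero_le_one (2 * (1 - ‖x‖))

theorem dist_coneTime_le (x y : E3) : dist (coneTime x) (coneTime y) ≤ 2 * dist x y := by
  refine ((LipschitzWith.projIcc zero_le_one).dist_le_mul _ _).trans ?_
  rw [NNReal.coe_one, one_mul, Real.dist_eq, dist_eq_norm,
    show 2 * (1 - ‖x‖) - 2 * (1 - ‖y‖) = 2 * (‖y‖ - ‖x‖) by ring, abs_mul, abs_two, norm_sub_rev]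
  gcongr
  exact abs_norm_sub_norm_le y x

theorem coneTime_eq_one {x : E3} (hx : ‖x‖ ≤ 1 / 2) : coneTime x = 1 :=
  Set.projIcc_of_right_le _ (by linarith)

theorem coneTime_eq_zero {x : E3} (hx : 1 ≤ ‖x‖) : coneTime x = 0 :=
  Set.projIcc_of_le_left _ (by linarith)

/-- A null homotopy read on the cone over the sphere, with a ball of radius `1 / 2` mapped to the
end point, and continued radially off the unit ball. -/
noncomputable def coneMap (K : S2 × unitInterval → E3) (x : E3) : E3 := K (direction x, coneTime x)

theorem coneMap_smul (K : S2 × unitInterval → E3) (p : S2) (t : unitInterval) :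
    K (p, t) = coneMap K ((1 - 1 / 2 * (t : ℝ)) • (p : E3)) := by
  have hp : ‖(p : E3)‖ = 1 := by simp
  have hr : 0 < 1 - 1 / 2 * (t : ℝ) := by linarith [t.2.2]
  rw [coneMap, direction_smul p hr, coneTime, norm_smul, hp, Real.norm_of_nonneg hr.le,
    show 2 * (1 - (1 - 1 / 2 * (t : ℝ)) * 1) = t by ring, Set.projIcc_val]

theorem coneMap_eq_of_norm_le {ι : S2 → E3} {K : S2 × unitInterval → E3} (hK : IsNullHomotopy ι K)
    {x : E3} (hx : ‖x‖ ≤ 1 / 2) (p : S2) : coneMap K x = K (p, 1) := by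
  obtain ⟨c, hc⟩ := hK.terminal
  rw [coneMap, coneTime_eq_one hx, hc, hc]

/-- The direction is not Lipschitz near the origin, but there the map is constant. This is why the
cone map collapses a whole ball of radius `1 / 2` and not just the origin. -/
theorem lipschitzWith_coneMap {ι : S2 → E3} {K : S2 × unitInterval → E3}
    (hK : IsLipschitzNullHomotopy ι K) : ∃ L, LipschitzWith L (coneMap K) := by
  obtain ⟨L, hL⟩ := hK.lipschitz
  have small : ∀ x y : E3, ‖y‖ ≤ 1 / 2 → dist (coneMap K x) (coneMap K y) ≤ L * (4 * dist x y) := by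
    intro x y hy
    -- The end value is the same for all directions, so `y` may be given the direction of `x`; then
    -- only the times differ.
    rw [coneMap_eq_of_norm_le hK.toIsNullHomotopy hy (direction x), coneMap, ← coneTime_eq_one hy]
    refine (hL.dist_le_mul _ _).trans ?_
    gcongr
    rw [Prod.dist_eq, dist_self]
    have := dist_coneTime_le x y
    exact max_le (by positivity) (by linarith [dist_nonneg (x := x) (y := y)])
  refine ⟨L * 4, LipschitzWith.of_dist_le_mul fun x y => ?_⟩
  push_cast
  rw [mul_assoc]
  rcases le_total ‖y‖ (1 / 2) with hy | hy
  · exact small x y hy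
  rcases le_total ‖x‖ (1 / 2) with hx | hx
  · rw [dist_comm, dist_comm x y]
    exact small y x hx
  refine (hL.dist_le_mul _ _).trans ?_
  gcongr
  rw [Prod.dist_eq]
  have h1 := dist_coneTime_le x y
  refine max_le (dist_direction_le hx ?_) (by linarith [dist_nonneg (x := x) (y := y)])
  rintro rfl
  norm_num at hy

theorem coneMap_eqOn_compl {ι : S2 → E3} {K K' : S2 × unitInterval → E3}
    (hK : IsNullHomotopy ι K) (hK' : IsNullHomotopy ι K') :
    Set.EqOn (coneMap K) (coneMap K') (Metric.ball 0 1)ᶜ := by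
  intro x hx
  have hx : 1 ≤ ‖x‖ := by simpa using hx
  rw [coneMap, coneMap, coneTime_eq_zero hx, hK.initial, hK'.initial]

theorem det_fderiv_coneMap_eq_zero {ι : S2 → E3} {K : S2 × unitInterval → E3}
    (hK : IsNullHomotopy ι K) {x : E3} (hx : ‖x‖ < 1 / 2) : (fderiv ℝ (coneMap K) x).det = 0 := by
  have h : coneMap K =ᶠ[nhds x] fun _ => K (direction 0, 1) := by
    have : ∀ᶠ y : E3 in nhds x, ‖y‖ < 1 / 2 := continuous_norm.continuousAt.eventually_lt_const hx
    filter_upwards [this] with y hy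
    exact coneMap_eq_of_norm_le hK hy.le _
  rw [h.fderiv_eq, fderiv_fun_const]
  exact LinearMap.det_zero' (EuclideanSpace.basisFun (Fin 3) ℝ).toBasis

/-- The determinant vanishes on the open ball of radius `1 / 2`, and its bounding sphere is null. -/
theorem integral_shell_coneMap {ι : S2 → E3} {K : S2 × unitInterval → E3}
    (hK : IsNullHomotopy ι K) :
    ∫ x in shell (1 / 2), (fderiv ℝ (coneMap K) x).det =
      ∫ x in Metric.ball 0 1, (fderiv ℝ (coneMap K) x).det := by
  refine (setIntegral_eq_of_subset_of_ae_sdiff_eq_zero measurableSet_ball.nullMeasurableSet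
    Set.sdiff_subset ?_).symm
  have hs : ∀ᵐ x : E3, x ∉ Metric.sphere (0 : E3) (1 / 2) :=
    measure_eq_zero_iff_ae_notMem.1 (Measure.addHaar_sphere _ _ _)
  filter_upwards [hs] with x hx hx'
  refine det_fderiv_coneMap_eq_zero hK (lt_of_le_of_ne ?_ (by simpa using hx))
  have h1 := hx'.2
  simp only [Set.mem_sdiff, hx'.1, true_and, not_not, mem_closedBall_zero_iff] at h1
  linarith

/-- Lipschitz null homotopies of the same map have the same signed swept volume. -/
theorem signedVolume_eq {ι : S2 → E3} {K K' : S2 × unitInterval → E3}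
    (hK : IsLipschitzNullHomotopy ι K) (hK' : IsLipschitzNullHomotopy ι K') :
    signedVolume K = signedVolume K' := by
  obtain ⟨L, hL⟩ := lipschitzWith_coneMap hK
  obtain ⟨L', hL'⟩ := lipschitzWith_coneMap hK'
  rw [signedVolume_eq_integral_shell (by norm_num) (by norm_num) (coneMap_smul K)
      (hL.ae_differentiableAt.mono fun _ h _ => h),
    signedVolume_eq_integral_shell (by norm_num) (by norm_num) (coneMap_smul K')
      (hL'.ae_differentiableAt.mono fun _ h _ => h),
    integral_shell_coneMap hK.toIsNullHomotopy, integral_shell_coneMap hK'.toIsNullHomotopy,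
    setIntegral_det_fderiv_congr hL hL' measurableSet_ball measure_ball_lt_top.ne
      (coneMap_eqOn_compl hK.toIsNullHomotopy hK'.toIsNullHomotopy)]

/-! ### Immersions of the closed ball: finite fibres, area formula and degree -/

namespace IsOrientedBallImmersion

variable {G : E3 → E3}

theorem uniqueDiffOn_B3 : UniqueDiffOn ℝ B3 :=
  uniqueDiffOn_convex (convex_closedBall _ _)
    ⟨0, by rw [interior_closedBall _ one_ne_zero]; simp⟩

theorem hasFDerivWithinAt (hG : IsOrientedBallImmersion G) {x : E3} (hx : x ∈ B3) :
    HasFDerivWithinAt G (fderivWithin ℝ G B3 x) B3 x :=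
  (hG.smooth.differentiableOn (by simp) x hx).hasFDerivWithinAt

theorem continuousOn_fderivWithin (hG : IsOrientedBallImmersion G) :
    ContinuousOn (fderivWithin ℝ G B3) B3 :=
  hG.smooth.continuousOn_fderivWithin uniqueDiffOn_B3 (by simp)

theorem differentiableAt (hG : IsOrientedBallImmersion G) {x : E3} (hx : x ∈ Metric.ball 0 1) :
    DifferentiableAt ℝ G x :=
  (hG.smooth.differentiableOn (by simp) x (Metric.ball_subset_closedBall hx)).differentiableAt
    (Metric.closedBall_mem_nhds_of_mem hx)

theorem fderiv_eq {x : E3} (hx : x ∈ Metric.ball 0 1) :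
    fderiv ℝ G x = fderivWithin ℝ G B3 x :=
  (fderivWithin_of_mem_nhds (Metric.closedBall_mem_nhds_of_mem hx)).symm

theorem exists_lipschitzOnWith (hG : IsOrientedBallImmersion G) :
    ∃ L : NNReal, LipschitzOnWith L G B3 := by
  obtain ⟨C, hC⟩ := (isCompact_closedBall (0 : E3) 1).exists_bound_of_continuousOn
    hG.continuousOn_fderivWithin
  refine ⟨C.toNNReal, (convex_closedBall _ _).lipschitzOnWith_of_nnnorm_hasFDerivWithin_le
    (fun x hx => hG.hasFDerivWithinAt hx) fun x hx => ?_⟩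
  rw [← NNReal.coe_le_coe, coe_nnnorm]
  exact (hC x hx).trans (Real.le_coe_toNNReal C)

/-- The differential stays within `c / 2` of an invertible one that expands lengths by at least `c`.
The mean value inequality on the convex set `B3 ∩ ball` then gives injectivity, at boundary points
too. -/
theorem exists_ball_injOn (hG : IsOrientedBallImmersion G) {z : E3} (hz : z ∈ B3) :
    ∃ ε > 0, Set.InjOn G (B3 ∩ Metric.ball z ε) := by
  set A := (fderivWithin ℝ G B3 z).toContinuousLinearEquivOfDetNeZero (hG.det_pos z hz).ne'
  have hA : ∀ v, A v = fderivWithin ℝ G B3 z v := fun v => rfl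
  obtain ⟨c, hc, hcA⟩ : ∃ c > 0, ∀ v, c * ‖v‖ ≤ ‖fderivWithin ℝ G B3 z v‖ := by
    have hn : 0 < ‖(A.symm : E3 →L[ℝ] E3)‖ + 1 := by positivity
    refine ⟨(‖(A.symm : E3 →L[ℝ] E3)‖ + 1)⁻¹, inv_pos.2 hn, fun v => ?_⟩
    rw [inv_mul_le_iff₀ hn, ← hA]
    have := (A.symm : E3 →L[ℝ] E3).le_opNorm (A v)
    simp only [ContinuousLinearEquiv.coe_coe, ContinuousLinearEquiv.symm_apply_apply] at this
    nlinarith [norm_nonneg (A v)]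
  obtain ⟨ε, hε, hB⟩ := Metric.continuousWithinAt_iff.1 (hG.continuousOn_fderivWithin z hz) (c / 2)
    (by positivity)
  refine ⟨ε, hε, fun x hx y hy hxy => ?_⟩
  have h := Convex.norm_image_sub_le_of_norm_hasFDerivWithin_le' (f := G)
    (f' := fderivWithin ℝ G B3) (φ := fderivWithin ℝ G B3 z) (C := c / 2)
    (fun w hw => (hG.hasFDerivWithinAt hw.1).mono Set.inter_subset_left)
    (fun w hw => by rw [← dist_eq_norm]; exact (hB hw.1 hw.2).le)
    ((convex_closedBall _ _).inter (convex_ball _ _)) hx hy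
  rw [hxy, sub_self, zero_sub, norm_neg] at h
  have h2 := hcA (y - x)
  have h3 : ‖y - x‖ ≤ 0 := by
    by_contra! h4
    nlinarith
  exact (sub_eq_zero.1 (norm_le_zero_iff.1 h3)).symm

/-- Compactness: the ball is covered by finitely many sets on each of which `G` is injective. -/
theorem finite_fiber (hG : IsOrientedBallImmersion G) (y : E3) : (B3 ∩ G ⁻¹' {y}).Finite := by
  refine (isCompact_closedBall (0 : E3) 1).induction_on (p := fun s => (s ∩ G ⁻¹' {y}).Finite)
    (by simp) (fun s t hst ht => ht.subset (Set.inter_subset_inter_left _ hst))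
    (fun s t hs ht => by rw [Set.union_inter_distrib_right]; exact hs.union ht) fun z hz => ?_
  obtain ⟨ε, hε, hinj⟩ := hG.exists_ball_injOn hz
  refine ⟨B3 ∩ Metric.ball z ε, Filter.inter_mem self_mem_nhdsWithin
    (mem_nhdsWithin_of_mem_nhds (Metric.ball_mem_nhds z hε)), Set.Subsingleton.finite ?_⟩
  intro a ha b hb
  exact hinj ha.1 hb.1 (ha.2.trans hb.2.symm)

/-- The area formula, counting preimages. -/
theorem measurable_ncard_and_lintegral_ncard (hG : IsOrientedBallImmersion G) {t : Set E3}
    (ht : MeasurableSet t) (htB : t ⊆ B3) :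
    Measurable (fun y => ((t ∩ G ⁻¹' {y}).ncard : ENNReal)) ∧
      ∫⁻ y, ((t ∩ G ⁻¹' {y}).ncard : ENNReal) =
        ∫⁻ x in t, ENNReal.ofReal |(fderivWithin ℝ G B3 x).det| := by
  -- Compactness induction needs a property that survives unions, so the formula is asked of all
  -- measurable subsets of a piece `m`. On `m ∪ m'` a set `t` is split into `t ∩ m` and `t \ m`; on
  -- a small piece `G` is injective and the count is an indicator function.
  suffices H : ∃ m, B3 ⊆ m ∧ MeasurableSet m ∧ ∀ t ⊆ m, MeasurableSet t → t ⊆ B3 →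
      Measurable (fun y => ((t ∩ G ⁻¹' {y}).ncard : ENNReal)) ∧
      ∫⁻ y, ((t ∩ G ⁻¹' {y}).ncard : ENNReal) =
        ∫⁻ x in t, ENNReal.ofReal |(fderivWithin ℝ G B3 x).det| by
    obtain ⟨m, hm, -, H⟩ := H
    exact H t (htB.trans hm) ht htB
  refine (isCompact_closedBall (0 : E3) 1).induction_on (p := fun s => ∃ m, s ⊆ m ∧
      MeasurableSet m ∧ ∀ t ⊆ m, MeasurableSet t → t ⊆ B3 →
      Measurable (fun y => ((t ∩ G ⁻¹' {y}).ncard : ENNReal)) ∧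
      ∫⁻ y, ((t ∩ G ⁻¹' {y}).ncard : ENNReal) =
        ∫⁻ x in t, ENNReal.ofReal |(fderivWithin ℝ G B3 x).det|) ?_ ?_ ?_ ?_
  · refine ⟨∅, subset_rfl, .empty, fun t ht _ _ => ?_⟩
    simp [Set.subset_empty_iff.1 ht]
  · rintro s s' hs ⟨m, hm, h⟩
    exact ⟨m, hs.trans hm, h⟩
  · rintro s s' ⟨m, hm, hmm, h⟩ ⟨m', hm', hmm', h'⟩
    refine ⟨m ∪ m', Set.union_subset_union hm hm', hmm.union hmm', fun t ht htm htB => ?_⟩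
    obtain ⟨h1, h2⟩ := h (t ∩ m) Set.inter_subset_right (htm.inter hmm)
      (Set.inter_subset_left.trans htB)
    obtain ⟨h1', h2'⟩ := h' (t \ m) (fun x hx => (ht hx.1).resolve_left hx.2) (htm.diff hmm)
      (Set.sdiff_subset.trans htB)
    have key : ∀ y, ((t ∩ G ⁻¹' {y}).ncard : ENNReal) =
        ((t ∩ m ∩ G ⁻¹' {y}).ncard : ENNReal) + ((t \ m ∩ G ⁻¹' {y}).ncard : ENNReal) := by
      intro y
      -- Additivity of `ncard` relies on finite fibres, since `ncard` is `0` on infinite sets.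
      rw [← Nat.cast_add, ← Set.ncard_union_eq ?_ ?_ ?_, ← Set.union_inter_distrib_right,
        Set.inter_union_sdiff]
      · exact Set.disjoint_of_subset Set.inter_subset_left Set.inter_subset_left
          Set.disjoint_sdiff_inter.symm
      · exact (hG.finite_fiber y).subset (Set.inter_subset_inter_left _
          (Set.inter_subset_left.trans htB))
      · exact (hG.finite_fiber y).subset (Set.inter_subset_inter_left _
          (Set.sdiff_subset.trans htB))
    simp only [key]
    refine ⟨h1.add h1', ?_⟩
    rw [lintegral_add_left h1, h2, h2', lintegral_inter_add_sdiff _ _ hmm]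
  · intro z hz
    obtain ⟨ε, hε, hinj⟩ := hG.exists_ball_injOn hz
    refine ⟨B3 ∩ Metric.ball z ε, Filter.inter_mem self_mem_nhdsWithin
      (mem_nhdsWithin_of_mem_nhds (Metric.ball_mem_nhds z hε)), _, subset_rfl,
      measurableSet_closedBall.inter measurableSet_ball, fun t ht htm htB => ?_⟩
    have hinj := hinj.mono ht
    have hd : ∀ x ∈ t, HasFDerivWithinAt G (fderivWithin ℝ G B3 x) t x := fun x hx =>
      (hG.hasFDerivWithinAt (htB hx)).mono htB
    have hm := measurable_image_of_fderivWithin htm hd hinj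
    have key : (fun y => ((t ∩ G ⁻¹' {y}).ncard : ENNReal)) = (G '' t).indicator 1 := by
      ext y
      by_cases hy : y ∈ G '' t
      · obtain ⟨x, hx, rfl⟩ := hy
        have : t ∩ G ⁻¹' {G x} = {x} := by
          ext w
          constructor
          · rintro ⟨h1, h2⟩
            exact hinj h1 hx h2
          · rintro rfl
            exact ⟨hx, rfl⟩
        rw [Set.indicator_of_mem (Set.mem_image_of_mem G hx), this]
        simp
      · have : t ∩ G ⁻¹' {y} = ∅ := by
          ext w
          simp only [Set.mem_inter_iff, Set.mem_empty_iff_false, iff_false]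
          rintro ⟨h1, h2⟩
          exact hy ⟨w, h1, h2⟩
        rw [Set.indicator_of_notMem hy, this]
        simp
    rw [key]
    refine ⟨measurable_one.indicator hm, ?_⟩
    rw [lintegral_indicator_one hm, lintegral_abs_det_fderiv_eq_addHaar_image volume htm hd hinj]

theorem brouwerDegree_eq_ncard (hG : IsOrientedBallImmersion G) (y : E3) :
    brouwerDegree G (Metric.ball 0 1) y = (Metric.ball 0 1 ∩ G ⁻¹' {y}).ncard := by
  have hfin : (Metric.ball 0 1 ∩ G ⁻¹' {y}).Finite :=
    (hG.finite_fiber y).subset (Set.inter_subset_inter_left _ Metric.ball_subset_closedBall)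
  have h1 : brouwerDegree G (Metric.ball 0 1) y =
      ∑ᶠ x ∈ Metric.ball 0 1 ∩ G ⁻¹' {y}, (1 : ℤ) := by
    refine finsum_mem_congr rfl fun x hx => ?_
    rw [fderiv_eq hx.1, sign_pos (hG.det_pos x (Metric.ball_subset_closedBall hx.1))]
    rfl
  rw [h1, finsum_mem_eq_finite_toFinset_sum _ hfin, Set.ncard_eq_toFinset_card _ hfin]
  simp

theorem lintegral_ball_ne_top (hG : IsOrientedBallImmersion G) :
    ∫⁻ x in Metric.ball 0 1, ENNReal.ofReal |(fderivWithin ℝ G B3 x).det| ≠ ⊤ := by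
  obtain ⟨C, hC⟩ := (isCompact_closedBall (0 : E3) 1).exists_bound_of_continuousOn
    (continuous_det_clm.comp_continuousOn hG.continuousOn_fderivWithin)
  refine ((setLIntegral_mono' measurableSet_ball (g := fun _ => ENNReal.ofReal C)
    fun x hx => ENNReal.ofReal_le_ofReal (hC x (Metric.ball_subset_closedBall hx))).trans_lt ?_).ne
  rw [setLIntegral_const]
  exact ENNReal.mul_lt_top ENNReal.ofReal_lt_top measure_ball_lt_top

theorem shell_one_ae_eq : (shell 1 : Set E3) =ᵐ[volume] Metric.ball (0 : E3) 1 := by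
  rw [shell, sub_self, Metric.closedBall_zero]
  exact sdiff_null_ae_eq_self (measure_singleton _)

/-! ### The cone homotopy of an immersion -/

/-- `G` read on the cone over the sphere. -/
def coneHomotopy (G : E3 → E3) (q : S2 × unitInterval) : E3 := G ((1 - (q.2 : ℝ)) • (q.1 : E3))

theorem smul_mem_B3 (q : S2 × unitInterval) : (1 - (q.2 : ℝ)) • (q.1 : E3) ∈ B3 := by
  have h : 0 ≤ 1 - (q.2 : ℝ) := by linarith [q.2.2.2]
  rw [mem_closedBall_zero_iff, norm_smul, Real.norm_of_nonneg h]
  simp [q.2.2.1]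

theorem contMDiff_coneHomotopy (hG : IsOrientedBallImmersion G) :
    ContMDiff ((𝓡 2).prod (𝓡∂ 1)) 𝓘(ℝ, E3) ∞ (coneHomotopy G) := by
  have h1 : ContMDiff ((𝓡 2).prod (𝓡∂ 1)) 𝓘(ℝ, E3) ∞
      fun q : S2 × unitInterval => (q.1 : E3) := contMDiff_coe_sphere.comp contMDiff_fst
  have h2 : ContMDiff ((𝓡 2).prod (𝓡∂ 1)) 𝓘(ℝ, ℝ) ∞
      fun q : S2 × unitInterval => (q.2 : ℝ) := contMDiff_subtypeVal_Icc.comp contMDiff_snd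
  have h3 : ContMDiff ((𝓡 2).prod (𝓡∂ 1)) 𝓘(ℝ, E3) ∞
      fun q : S2 × unitInterval => (1 - (q.2 : ℝ)) • (q.1 : E3) :=
    (contMDiff_const.sub h2).smul h1
  exact hG.smooth.contMDiffOn.comp_contMDiff h3 smul_mem_B3

theorem isLipschitzNullHomotopy_coneHomotopy (hG : IsOrientedBallImmersion G) {ι : S2 → E3}
    (hι : ∀ p : S2, G p = ι p) : IsLipschitzNullHomotopy ι (coneHomotopy G) := by
  obtain ⟨L, hL⟩ := hG.exists_lipschitzOnWith
  have hlip : LipschitzWith (L * 2) (coneHomotopy G) := by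
    refine LipschitzWith.of_dist_le_mul fun q q' => ?_
    refine (hL.dist_le_mul _ (smul_mem_B3 q) _ (smul_mem_B3 q')).trans ?_
    rw [NNReal.coe_mul, mul_assoc]
    gcongr
    have h1 : dist (q.1 : E3) q'.1 ≤ dist q q' := le_max_left _ _
    have h2 : |(q'.2 : ℝ) - q.2| ≤ dist q q' := by
      rw [← Real.dist_eq, dist_comm]; exact le_max_right _ _
    have h3 : |1 - (q.2 : ℝ)| ≤ 1 := abs_le.2 ⟨by linarith [q.2.2.2], by linarith [q.2.2.1]⟩
    have e : (1 - (q.2 : ℝ)) • (q.1 : E3) - (1 - (q'.2 : ℝ)) • (q'.1 : E3) =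
        (1 - (q.2 : ℝ)) • ((q.1 : E3) - q'.1) + ((q'.2 : ℝ) - q.2) • (q'.1 : E3) := by
      module
    have hq : ‖(q'.1 : E3)‖ = 1 := by simp
    rw [dist_eq_norm, e]
    refine (norm_add_le _ _).trans ?_
    rw [norm_smul, norm_smul, hq, Real.norm_eq_abs, Real.norm_eq_abs, mul_one, ← dist_eq_norm (q.1 : E3)]
    have := mul_le_mul h3 h1 dist_nonneg zero_le_one
    push_cast
    linarith
  exact ⟨⟨hlip.continuous, fun p => by simp [coneHomotopy, hι], G 0, fun p => by
    simp [coneHomotopy]⟩, _, hlip⟩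

/-- Off the value `G 0` no preimage has time `1`, and at earlier times `(p, t) ↦ (1 - t) p` is
injective, so the fibre embeds in a fibre of `G`. -/
theorem finite_fiber_coneHomotopy (hG : IsOrientedBallImmersion G) {x : E3} (hx : x ≠ G 0) :
    (coneHomotopy G ⁻¹' {x}).Finite := by
  refine Set.Finite.of_finite_image (f := fun q : S2 × unitInterval =>
    (1 - (q.2 : ℝ)) • (q.1 : E3)) ((hG.finite_fiber x).subset ?_) ?_
  · rintro _ ⟨q, hq, rfl⟩
    exact ⟨smul_mem_B3 q, hq⟩
  · have hpos : ∀ q ∈ coneHomotopy G ⁻¹' {x}, 0 < 1 - (q.2 : ℝ) := by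
      intro q hq
      refine lt_of_le_of_ne (by linarith [q.2.2.2]) fun h => hx ?_
      have hq : G ((1 - (q.2 : ℝ)) • (q.1 : E3)) = x := hq
      rw [← hq, ← h, zero_smul]
    rintro ⟨p, t⟩ hq ⟨p', t'⟩ hq' h
    have h1 := hpos _ hq
    have h2 := hpos _ hq'
    simp only at h h1 h2
    have hp := congrArg direction h
    rw [direction_smul p h1, direction_smul p' h2] at hp
    have hn := congrArg norm h
    rw [norm_smul, norm_smul, Real.norm_of_nonneg h1.le, Real.norm_of_nonneg h2.le] at hn
    simp at hn
    rw [hp, Subtype.ext hn]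

theorem coneHomotopy_eq (p : S2) (t : unitInterval) :
    coneHomotopy G (p, t) = G ((1 - 1 * (t : ℝ)) • (p : E3)) := by
  rw [one_mul]; rfl

theorem ae_differentiableAt_shell (hG : IsOrientedBallImmersion G) :
    ∀ᵐ x, x ∈ shell 1 → DifferentiableAt ℝ G x :=
  .of_forall fun _ hx => hG.differentiableAt hx.1

theorem sweptVolume_coneHomotopy (hG : IsOrientedBallImmersion G) :
    sweptVolume (coneHomotopy G) =
      ∫⁻ x in Metric.ball 0 1, ENNReal.ofReal |(fderivWithin ℝ G B3 x).det| := by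
  rw [sweptVolume_eq_lintegral_shell one_pos le_rfl coneHomotopy_eq hG.ae_differentiableAt_shell,
    setLIntegral_congr shell_one_ae_eq]
  exact setLIntegral_congr_fun measurableSet_ball fun x hx => by simp only [fderiv_eq hx]

/-- Preservation of orientation rules out cancellation, which is the equality case of the lower
bound. -/
theorem abs_signedVolume_coneHomotopy (hG : IsOrientedBallImmersion G) :
    |signedVolume (coneHomotopy G)| = (sweptVolume (coneHomotopy G)).toReal := by
  have hpos : ∀ x ∈ shell 1, 0 < (fderiv ℝ G x).det := fun x hx => by
    rw [fderiv_eq hx.1]; exact hG.det_pos x (Metric.ball_subset_closedBall hx.1)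
  rw [signedVolume_eq_integral_shell one_pos le_rfl coneHomotopy_eq hG.ae_differentiableAt_shell,
    sweptVolume_eq_lintegral_shell one_pos le_rfl coneHomotopy_eq hG.ae_differentiableAt_shell,
    abs_neg, abs_of_nonneg (setIntegral_nonneg (measurableSet_shell 1) fun x hx => (hpos x hx).le),
    integral_eq_lintegral_of_nonneg_ae
      ((ae_restrict_iff' (measurableSet_shell 1)).2 (.of_forall fun x hx => (hpos x hx).le))
      (measurable_det_fderiv G).aestronglyMeasurable]
  congr 1
  exact setLIntegral_congr_fun (measurableSet_shell 1) fun x hx => by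
    simp only [abs_of_pos (hpos x hx)]

theorem integrable_brouwerDegree (hG : IsOrientedBallImmersion G) :
    Integrable (fun x : E3 => (brouwerDegree G (Metric.ball 0 1) x : ℝ)) ∧
      (sweptVolume (coneHomotopy G)).toReal =
        ∫ x : E3, (brouwerDegree G (Metric.ball 0 1) x : ℝ) := by
  obtain ⟨hm, hi⟩ := hG.measurable_ncard_and_lintegral_ncard measurableSet_ball
    Metric.ball_subset_closedBall
  have hd : (fun x : E3 => (brouwerDegree G (Metric.ball 0 1) x : ℝ)) =
      fun x => ((Metric.ball 0 1 ∩ G ⁻¹' {x}).ncard : ENNReal).toReal := by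
    ext x
    rw [hG.brouwerDegree_eq_ncard]
    simp
  have hfin := hG.lintegral_ball_ne_top
  rw [hd, hG.sweptVolume_coneHomotopy, ← hi]
  rw [← hi] at hfin
  exact ⟨integrable_toReal_of_lintegral_ne_top hm.aemeasurable hfin,
    (integral_toReal hm.aemeasurable (.of_forall fun x => ENNReal.natCast_lt_top _)).symm⟩

theorem volume_range_eq_zero (hG : IsOrientedBallImmersion G) {ι : S2 → E3}
    (hι : ∀ p : S2, G p = ι p) : volume (Set.range ι) = 0 := by
  have h : Set.range ι = G '' S2 := by
    rw [Set.image_eq_range]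
    exact congrArg Set.range (funext fun p => (hι p).symm)
  rw [h]
  exact addHaar_image_eq_zero_of_differentiableOn_of_addHaar_eq_zero _
    ((hG.smooth.differentiableOn (by simp)).mono Metric.sphere_subset_closedBall)
    (Measure.addHaar_sphere _ _ _)

end IsOrientedBallImmersion

open IsOrientedBallImmersion in
theorem proposition3p4 (ι : S2 → E3) (G : E3 → E3) (hG : IsOrientedBallImmersion G)
    (hι : ∀ p : S2, G p = ι p) :
    ∃ H : S2 × unitInterval → E3,
      -- `H` is `G` read on the cone `S² × [0,1] / S² × {1}`
      (∀ (p : S2) (t : unitInterval), H (p, t) = G ((1 - (t : ℝ)) • (p : E3))) ∧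
      -- `H` is a smooth, Lipschitz null homotopy of `ι`, with finite fibres off its end point
      ContMDiff ((𝓡 2).prod (𝓡∂ 1)) 𝓘(ℝ, E3) ∞ H ∧
      IsLipschitzNullHomotopy ι H ∧
      (∀ x : E3, x ≠ G 0 → (H ⁻¹' {x}).Finite) ∧
      -- the degree is defined off a null set and integrable; its integral is the swept volume
      volume (Set.range ι) = 0 ∧
      Integrable (fun x : E3 => (brouwerDegree G (Metric.ball 0 1) x : ℝ)) ∧
      sweptVolume H ≠ ⊤ ∧
      (sweptVolume H).toReal = ∫ x : E3, (brouwerDegree G (Metric.ball 0 1) x : ℝ) ∧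
      -- this is the lower bound for the swept volume of every Lipschitz null homotopy of `ι`
      (∀ K : S2 × unitInterval → E3, IsLipschitzNullHomotopy ι K →
        ENNReal.ofReal |∫ x : E3, (brouwerDegree G (Metric.ball 0 1) x : ℝ)|
          ≤ sweptVolume K) := by
  have hH := hG.isLipschitzNullHomotopy_coneHomotopy hι
  obtain ⟨hint, hvol⟩ := hG.integrable_brouwerDegree
  refine ⟨coneHomotopy G, fun p t => rfl, hG.contMDiff_coneHomotopy, hH,
    fun x hx => hG.finite_fiber_coneHomotopy hx, hG.volume_range_eq_zero hι, hint, ?_, hvol,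
    fun K hK => ?_⟩
  · rw [hG.sweptVolume_coneHomotopy]
    exact hG.lintegral_ball_ne_top
  -- The integral of the degree is the absolute signed volume of the cone homotopy, hence also that
  -- of `K`.
  · rw [← hvol, abs_of_nonneg ENNReal.toReal_nonneg, ← hG.abs_signedVolume_coneHomotopy,
      signedVolume_eq hH hK]
    exact ofReal_abs_signedVolume_le_sweptVolume K
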